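/- Let $D$ be a ring with one and let $M, L, N$ be (left) $D$-modules. Morphisms and cocycles are composed from left to right: for $\xi\in\operatorname{Ext}^i(A,B)$ and $\zeta\in\operatorname{Ext}^j(B,C)$ the Yoneda product is written $\xi\circ\zeta\in\operatorname{Ext}^{i+j}(A,C)$, where $\operatorname{Ext}^0=\operatorname{Hom}$. Let $\eta^M_L\in\operatorname{Ext}^1(M,L)$ and $\eta^L_N\in\operatorname{Ext}^1(L,N)$. A $2$-extension module with subfactors $M,L,N$ is a $D$-module $E$ with submodules $E\ge E_1\ge E_2\ge 0$ and fixed identifications $E/E_1\cong M$, $E_1/E_2\cong L$, $E_2\cong N$. Let $\operatorname{ExtMod}(\eta^M_L,\eta^L_N)$ be the set of those $2$-extension modules for which $0\to L\to E/E_2\to M\to 0$ has class $\eta^M_L$ and $0\to N\to E_1\to L\to 0$ has class $\eta^L_N$, up to filtered isomorphism, i.e. up to isomorphisms $\alpha:E\to E'$ with $\alpha(E_i)=E_i'$ $(i=1,2)$ which induce the identity on the subfactors $M$, $L$, $N$. If $0\to N\xrightarrow{\iota}G_1\xrightarrow{\pi}L\to0$ is an exact sequence with class $\eta^L_N$, then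 $\operatorname{Ext}^1(M,N)$ acts by $(\xi,x)\mapsto \xi\circ\iota+x$ on the fiber $(\pi_*)^{-1}(\eta^M_L)$ of $\pi_*:\operatorname{Ext}^1(M,G_1)\to\operatorname{Ext}^1(M,L)$; an element $x$ of this fiber induces the $2$-extension modules $E$ for which, after some isomorphism $E_1\cong G_1$ of extensions of $L$ by $N$, the sequence $0\to G_1\to E\to M\to 0$ has class $x$. If $0\to L\xrightarrow{\iota}G_0\xrightarrow{\pi}M\to0$ is an exact sequence with class $\eta^M_L$, then $\operatorname{Ext}^1(M,N)$ acts by $(\xi,y)\mapsto \pi\circ\xi+y$ on the fiber $(\iota^*)^{-1}(\eta^L_N)$ of $\iota^*:\operatorname{Ext}^1(G_0,N)\to\operatorname{Ext}^1(L,N)$; an element $y$ of this fiber induces the $2$-extension modules $E$ for which, after some isomorphism $E/E_2\cong G_0$ of extensions of $M$ by $L$, the sequence $0\to N\to E\to G_0\to 0$ has class $y$. Then: 1. If $\operatorname{ExtMod}(\eta^M_L,\eta^L_N)$ is non-empty, it is a principal homogeneous space for the abelian group $$\operatorname{Ext}^1(\eta^M_L,\eta^L_N):=\operatorname{Ext}^1(M,N)\big/\bigl(\operatorname{Hom}(M,L)\circ\eta^L_N+\eta^M_L\circ\operatorname{Hom}(L,N)\bigr),$$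 under an action that is compatible with the two actions above: for every $G_1$ (respectively $G_0$) as above, if $E$ is induced by $x$ and $E'$ by $\xi\circ\iota+x$ (respectively $E$ by $y$ and $E'$ by $\pi\circ\xi+y$), then the class of $\xi\in\operatorname{Ext}^1(M,N)$ maps the class of $E$ to the class of $E'$. 2. For every such $G_1$ there is a bijection $$\operatorname{ExtMod}(\eta^M_L,\eta^L_N)\cong(\pi_*)^{-1}(\eta^M_L)\big/\bigl(\eta^M_L\circ\operatorname{Hom}(L,N)\bigr)$$ onto the set of orbits of the subgroup $\eta^M_L\circ\operatorname{Hom}(L,N)\le\operatorname{Ext}^1(M,N)$, under which the class of $E$ corresponds to the orbit of $x$ exactly when $E$ is induced by $x$. 3. For every such $G_0$ there is a bijection $$\operatorname{ExtMod}(\eta^M_L,\eta^L_N)\cong(\iota^*)^{-1}(\eta^L_N)\big/\bigl(\operatorname{Hom}(M,L)\circ\eta^L_N\bigr)$$ onto the set of orbits of the subgroup $\operatorname{Hom}(M,L)\circ\eta^L_N\le\operatorname{Ext}^1(M,N)$, under which the class of $E$ corresponds to the orbit of $y$ exactly when $E$ is induced by $y$. -/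

import Mathlib

open CategoryTheory CategoryTheory.Abelian

universe u v

noncomputable section

/-- A `1`-extension `0 ← M ← G ← N ← 0` of `N` with `M`. -/
structure OneExtension {D : Type u} [Ring D] (M N : ModuleCat.{v} D) where
  G : ModuleCat.{v} D
  ι : N ⟶ G
  π : G ⟶ M
  zero : ι ≫ π = 0
  shortExact : (ShortComplex.mk ι π zero).ShortExact

namespace OneExtension

variable {D : Type u} [Ring D] {M N : ModuleCat.{v} D}

/-- The `1`-extension given by an injective linear map `i` and a surjective linear map `p` with
`range i = ker p`. -/
def ofLinearMaps {G : ModuleCat.{v} D} (i : N →ₗ[D] G) (p : G →ₗ[D] M)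
    (hi : Function.Injective i) (hp : Function.Surjective p) (h : Function.Exact i p) :
    OneExtension M N where
  G := G
  ι := ModuleCat.ofHom i
  π := ModuleCat.ofHom p
  zero := by ext x; exact h.apply_apply_eq_zero x
  shortExact := ModuleCat.shortComplex_shortExact _ h hi hp

/-- The `1`-cocycle in `Ext¹(M, N)` corresponding to a `1`-extension of `N` with `M`. -/
def cocycle [Small.{v} D] (X : OneExtension M N) : Ext M N 1 :=
  X.shortExact.extClass

/-- A congruence of `1`-extensions: an isomorphism of the middle modules compatible with the
identities of `N` and `M`. -/
structure Congruence (X Y : OneExtension M N) where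
  iso : X.G ≅ Y.G
  comm_ι : X.ι ≫ iso.hom = Y.ι
  comm_π : iso.hom ≫ Y.π = X.π

end OneExtension

/-- A `2`-extension module `E ≥ E₁ ≥ E₂ ≥ 0` with subfactors `E / E₁ = M`, `E₁ / E₂ = L` and
`E₂ = N`. The identifications with the prescribed modules `M`, `L`, `N` are part of the data. -/
structure TwoExtensionModule {D : Type u} [Ring D] (M L N : ModuleCat.{v} D) where
  E : ModuleCat.{v} D
  E₁ : Submodule D E
  E₂ : Submodule D E
  le : E₂ ≤ E₁
  grM : (E ⧸ E₁) ≃ₗ[D] M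
  grL : (E₁ ⧸ E₂.comap E₁.subtype) ≃ₗ[D] L
  grN : E₂ ≃ₗ[D] N

namespace TwoExtensionModule

variable {D : Type u} [Ring D] {M L N : ModuleCat.{v} D}

/-- The `1`-extension `0 ← M ← E / E₂ ← L ← 0`, where `L = E₁ / E₂`. -/
def G₀ (A : TwoExtensionModule M L N) : OneExtension M L :=
  OneExtension.ofLinearMaps (G := ModuleCat.of D (A.E ⧸ A.E₂))
    (((A.E₂.comap A.E₁.subtype).mapQ A.E₂ A.E₁.subtype le_rfl).comp A.grL.symm.toLinearMap)
    (A.grM.toLinearMap.comp (Submodule.factor A.le))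
    (by
      rw [LinearMap.coe_comp]
      refine Function.Injective.comp (g := (A.E₂.comap A.E₁.subtype).mapQ A.E₂ A.E₁.subtype le_rfl)
        ?_ A.grL.symm.injective
      rw [← LinearMap.ker_eq_bot, Submodule.ker_mapQ, Submodule.mkQ_map_self])
    (A.grM.surjective.comp (Submodule.factor_surjective A.le))
    (by
      intro y
      obtain ⟨e, rfl⟩ := Submodule.Quotient.mk_surjective _ y
      constructor
      · intro h
        have h1 : e ∈ A.E₁ := by simpa using h
        refine ⟨A.grL (Submodule.Quotient.mk ⟨e, h1⟩), ?_⟩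
        rw [LinearMap.comp_apply, LinearEquiv.coe_coe, LinearEquiv.symm_apply_apply]
        rfl
      · rintro ⟨l, hl⟩
        obtain ⟨z, rfl⟩ := A.grL.surjective l
        obtain ⟨z, rfl⟩ := Submodule.Quotient.mk_surjective _ z
        rw [LinearMap.comp_apply, LinearEquiv.coe_coe, LinearEquiv.symm_apply_apply] at hl
        rw [← hl]
        change A.grM (Submodule.Quotient.mk (z : A.E)) = 0
        rw [(Submodule.Quotient.mk_eq_zero A.E₁).2 z.2, map_zero])

/-- The `1`-extension `0 ← L ← E₁ ← N ← 0`, where `N = E₂`. -/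
def G₁ (A : TwoExtensionModule M L N) : OneExtension L N :=
  OneExtension.ofLinearMaps (G := ModuleCat.of D A.E₁)
    ((Submodule.inclusion A.le).comp A.grN.symm.toLinearMap)
    (A.grL.toLinearMap.comp (A.E₂.comap A.E₁.subtype).mkQ)
    ((Submodule.inclusion_injective A.le).comp A.grN.symm.injective)
    (A.grL.surjective.comp (Submodule.mkQ_surjective _))
    (by
      intro y
      change A.grL (Submodule.Quotient.mk y) = 0 ↔ _
      rw [LinearEquiv.map_eq_zero_iff, Submodule.Quotient.mk_eq_zero]
      constructor
      · intro h
        exact ⟨A.grN ⟨y, h⟩, by ext; simp⟩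
      · rintro ⟨n, rfl⟩
        exact (A.grN.symm n).2)

/-- The `1`-extension `0 ← M ← E ← E₁ ← 0`. -/
def upper (A : TwoExtensionModule M L N) : OneExtension M (ModuleCat.of D A.E₁) :=
  OneExtension.ofLinearMaps (G := A.E) A.E₁.subtype (A.grM.toLinearMap.comp A.E₁.mkQ)
    A.E₁.subtype_injective (A.grM.surjective.comp A.E₁.mkQ_surjective)
    (by intro y; simp)

/-- The `1`-extension `0 ← E / E₂ ← E ← N ← 0`. -/
def lower (A : TwoExtensionModule M L N) : OneExtension (ModuleCat.of D (A.E ⧸ A.E₂)) N :=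
  OneExtension.ofLinearMaps (G := A.E) (A.E₂.subtype.comp A.grN.symm.toLinearMap) A.E₂.mkQ
    (A.E₂.subtype_injective.comp A.grN.symm.injective) A.E₂.mkQ_surjective
    (by
      intro y
      constructor
      · intro h
        have h2 : y ∈ A.E₂ := by simpa using h
        exact ⟨A.grN ⟨y, h2⟩, by simp⟩
      · rintro ⟨n, rfl⟩
        simp)

/-- A filtered isomorphism `α : E ≅ E'`: it restricts to isomorphisms `Eᵢ ≅ E'ᵢ`, and the
isomorphisms it induces on the subfactors are the identities of `M`, `L` and `N`. -/
structure FilteredIso (A B : TwoExtensionModule M L N) where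
  α : A.E ≃ₗ[D] B.E
  mem₁ : ∀ e, α e ∈ B.E₁ ↔ e ∈ A.E₁
  mem₂ : ∀ e, α e ∈ B.E₂ ↔ e ∈ A.E₂
  grM_eq : ∀ e, B.grM (Submodule.Quotient.mk (α e)) = A.grM (Submodule.Quotient.mk e)
  grL_eq : ∀ (e : A.E) (he : e ∈ A.E₁),
    B.grL (Submodule.Quotient.mk ⟨α e, (mem₁ e).2 he⟩) = A.grL (Submodule.Quotient.mk ⟨e, he⟩)
  grN_eq : ∀ (e : A.E) (he : e ∈ A.E₂), B.grN ⟨α e, (mem₂ e).2 he⟩ = A.grN ⟨e, he⟩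

def FilteredIso.refl (A : TwoExtensionModule M L N) : FilteredIso A A where
  α := LinearEquiv.refl D A.E
  mem₁ _ := Iff.rfl
  mem₂ _ := Iff.rfl
  grM_eq _ := rfl
  grL_eq _ _ := rfl
  grN_eq _ _ := rfl

def FilteredIso.symm {A B : TwoExtensionModule M L N} (f : FilteredIso A B) :
    FilteredIso B A where
  α := f.α.symm
  mem₁ e := by rw [← f.mem₁, LinearEquiv.apply_symm_apply]
  mem₂ e := by rw [← f.mem₂, LinearEquiv.apply_symm_apply]
  grM_eq e := by rw [← f.grM_eq, LinearEquiv.apply_symm_apply]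
  grL_eq e he := by
    rw [← f.grL_eq]
    simp only [LinearEquiv.apply_symm_apply]
  grN_eq e he := by
    rw [← f.grN_eq]
    simp only [LinearEquiv.apply_symm_apply]

def FilteredIso.trans {A B C : TwoExtensionModule M L N} (f : FilteredIso A B)
    (g : FilteredIso B C) : FilteredIso A C where
  α := f.α.trans g.α
  mem₁ e := (g.mem₁ _).trans (f.mem₁ e)
  mem₂ e := (g.mem₂ _).trans (f.mem₂ e)
  grM_eq e := (g.grM_eq _).trans (f.grM_eq e)
  grL_eq e he := (g.grL_eq _ ((f.mem₁ e).2 he)).trans (f.grL_eq e he)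
  grN_eq e he := (g.grN_eq _ ((f.mem₂ e).2 he)).trans (f.grN_eq e he)

end TwoExtensionModule

section Cocycles

variable {D : Type u} [Ring D] [Small.{v} D] {M L N : ModuleCat.{v} D}

/-- The `2`-extension modules whose `1`-extensions `G₀` and `G₁` correspond to the cocycles `η`
and `η'`. -/
def AdmissibleModule (η : Ext M L 1) (η' : Ext L N 1) :=
  {A : TwoExtensionModule M L N // A.G₀.cocycle = η ∧ A.G₁.cocycle = η'}

instance admissibleSetoid (η : Ext M L 1) (η' : Ext L N 1) : Setoid (AdmissibleModule η η') where
  r A B := Nonempty (TwoExtensionModule.FilteredIso A.1 B.1)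
  iseqv :=
    { refl := fun A => ⟨.refl A.1⟩
      symm := fun ⟨f⟩ => ⟨f.symm⟩
      trans := fun ⟨f⟩ ⟨g⟩ => ⟨f.trans g⟩ }

/-- `ExtMod(η, η')`: admissible `2`-extension modules up to filtered isomorphism. -/
def ExtMod (η : Ext M L 1) (η' : Ext L N 1) := Quotient (admissibleSetoid η η')

/-- The class in `ExtMod(η, η')` of an admissible `2`-extension module. -/
def ExtMod.mk {η : Ext M L 1} {η' : Ext L N 1} (A : AdmissibleModule η η') : ExtMod η η' :=
  Quotient.mk _ A

/-- The subgroup `Hom(M, L) ∘ η'` of `Ext¹(M, N)`. (`Ext.comp` composes in diagrammatic order.) -/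
def homComp (M : ModuleCat.{v} D) (η' : Ext L N 1) : AddSubgroup (Ext M N 1) :=
  AddMonoidHom.range (AddMonoidHom.mk' (fun φ : M ⟶ L => (Ext.mk₀ φ).comp η' (zero_add 1))
    (fun a b => by rw [Ext.mk₀_add, Ext.add_comp]))

/-- The subgroup `η ∘ Hom(L, N)` of `Ext¹(M, N)`. -/
def compHom (η : Ext M L 1) (N : ModuleCat.{v} D) : AddSubgroup (Ext M N 1) :=
  AddMonoidHom.range (AddMonoidHom.mk' (fun ψ : L ⟶ N => η.comp (Ext.mk₀ ψ) (add_zero 1))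
    (fun a b => by rw [Ext.mk₀_add, Ext.comp_add]))

/-- The first extension group of `1`-cocycles,
`Ext¹(η, η') = Ext¹(M, N) / (Hom(M, L) ∘ η' + η ∘ Hom(L, N))`. -/
abbrev ExtOfCocycles (η : Ext M L 1) (η' : Ext L N 1) :=
  Ext M N 1 ⧸ (homComp M η' ⊔ compHom η N)

/-- The fiber over `η` of `π_* : Ext¹(M, G₁) → Ext¹(M, L)`. -/
def PushFiber (G₁ : OneExtension L N) (η : Ext M L 1) :=
  {x : Ext M G₁.G 1 // x.comp (Ext.mk₀ G₁.π) (add_zero 1) = η}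

/-- `Ext¹(M, N)` acts on the fiber of `π_*` by `(ξ, x) ↦ ι_* ξ + x`. -/
instance (G₁ : OneExtension L N) (η : Ext M L 1) :
    AddAction (Ext M N 1) (PushFiber G₁ η) where
  vadd ξ x := ⟨ξ.comp (Ext.mk₀ G₁.ι) (add_zero 1) + x.1, by
    rw [Ext.add_comp, x.2, Ext.comp_assoc_of_third_deg_zero, Ext.mk₀_comp_mk₀, G₁.zero,
      Ext.mk₀_zero, Ext.comp_zero, zero_add]⟩
  zero_vadd x := Subtype.ext (by
    change (0 : Ext M N 1).comp (Ext.mk₀ G₁.ι) (add_zero 1) + x.1 = x.1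
    rw [Ext.zero_comp, zero_add])
  add_vadd ξ ξ' x := Subtype.ext (by
    change (ξ + ξ').comp (Ext.mk₀ G₁.ι) (add_zero 1) + x.1 =
      ξ.comp (Ext.mk₀ G₁.ι) (add_zero 1) + (ξ'.comp (Ext.mk₀ G₁.ι) (add_zero 1) + x.1)
    rw [Ext.add_comp, add_assoc])

/-- The fiber over `η'` of `ι^* : Ext¹(G₀, N) → Ext¹(L, N)`. -/
def PullFiber (G₀ : OneExtension M L) (η' : Ext L N 1) :=
  {y : Ext G₀.G N 1 // (Ext.mk₀ G₀.ι).comp y (zero_add 1) = η'}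

/-- `Ext¹(M, N)` acts on the fiber of `ι^*` by `(ξ, y) ↦ π^* ξ + y`. -/
instance (G₀ : OneExtension M L) (η' : Ext L N 1) :
    AddAction (Ext M N 1) (PullFiber G₀ η') where
  vadd ξ y := ⟨(Ext.mk₀ G₀.π).comp ξ (zero_add 1) + y.1, by
    rw [Ext.comp_add, y.2, Ext.mk₀_comp_mk₀_assoc, G₀.zero, Ext.mk₀_zero, Ext.zero_comp,
      zero_add]⟩
  zero_vadd y := Subtype.ext (by
    change (Ext.mk₀ G₀.π).comp (0 : Ext M N 1) (zero_add 1) + y.1 = y.1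
    rw [Ext.comp_zero, zero_add])
  add_vadd ξ ξ' y := Subtype.ext (by
    change (Ext.mk₀ G₀.π).comp (ξ + ξ') (zero_add 1) + y.1 =
      (Ext.mk₀ G₀.π).comp ξ (zero_add 1) + ((Ext.mk₀ G₀.π).comp ξ' (zero_add 1) + y.1)
    rw [Ext.comp_add, add_assoc])

/-- The `1`-extension `0 ← M ← E ← G₁ ← 0`, obtained from `0 ← M ← E ← E₁ ← 0` through a
congruence between `G₁` and `0 ← L ← E₁ ← N ← 0`, has the class `x`. In other words, `E` is the
`2`-extension module which `x` induces. -/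
def InducedByPush (G₁ : OneExtension L N) (A : TwoExtensionModule M L N) (x : Ext M G₁.G 1) :
    Prop :=
  ∃ e : OneExtension.Congruence G₁ A.G₁,
    x.comp (Ext.mk₀ e.iso.hom) (add_zero 1) = A.upper.cocycle

/-- The `1`-extension `0 ← G₀ ← E ← N ← 0`, obtained from `0 ← E / E₂ ← E ← N ← 0` through a
congruence between `0 ← M ← E / E₂ ← L ← 0` and `G₀`, has the class `y`. -/
def InducedByPull (G₀ : OneExtension M L) (A : TwoExtensionModule M L N) (y : Ext G₀.G N 1) :
    Prop :=
  ∃ e : OneExtension.Congruence A.G₀ G₀,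
    (Ext.mk₀ e.iso.hom).comp y (zero_add 1) = A.lower.cocycle

end Cocycles

end

/-!
A `2`-extension module is determined up to filtered isomorphism by its class as an extension of `M`
by `G₁`, and equally by its class as an extension of `G₀` by `N`, once the automorphisms of `G₁`
(respectively `G₀`) over the identities are divided out: a morphism of short exact sequences with
prescribed outer components exists exactly when the two cocycles agree after pushing out and
pulling back. These automorphisms are `1 + π ≫ ψ ≫ ι`, which produces the orbits of
`η ∘ Hom(L, N)` and `Hom(M, L) ∘ η'`.

The actions of `ξ ∈ Ext¹(M, N)` on the two kinds of classes agree. If `ξ` takes `A` to `B` through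
the extensions by `G₁`, let `F` be the fibre product over `M` of `A` and an extension with class
`ξ`; it is a `2`-extension module with subfactors `M`, `L`, `N × N`. The projection and the
addition `N × N → N` are covered by filtered maps `F → A` and `F → B`. Comparing the classes of
the three modules as extensions by their lowest terms shows that `B` is also obtained from `A`
through the extensions of `G₀`.
-/

noncomputable section

local notation:75 x:75 " ▹ " f:76 => Ext.comp x (Ext.mk₀ f) (add_zero _)
local notation:75 f:76 " ◃ " x:75 => Ext.comp (Ext.mk₀ f) x (zero_add _)

lemma comp_mk₀_comp_mk₀ {C : Type*} [Category* C] [Abelian C] [HasExt C] {X Y Z W : C} {n : ℕ}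
    (x : Ext X Y n) (f : Y ⟶ Z) (g : Z ⟶ W) : (x ▹ f) ▹ g = x ▹ (f ≫ g) := by
  rw [Ext.comp_assoc_of_third_deg_zero, Ext.mk₀_comp_mk₀]

section

variable {D : Type u} [Ring D] [Small.{v} D] {M L N : ModuleCat.{v} D}

lemma mem_homComp {η' : Ext L N 1} {ξ : Ext M N 1} :
    ξ ∈ homComp M η' ↔ ∃ φ : M ⟶ L, φ ◃ η' = ξ := Iff.rfl

lemma mem_compHom {η : Ext M L 1} {ξ : Ext M N 1} :
    ξ ∈ compHom η N ↔ ∃ ψ : L ⟶ N, η ▹ ψ = ξ := Iff.rfl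

end

namespace OneExtension

variable {D : Type u} [Ring D] {M N M' N' : ModuleCat.{v} D}

instance (X : OneExtension M N) : Mono X.ι := X.shortExact.mono_f

instance (X : OneExtension M N) : Epi X.π := X.shortExact.epi_g

lemma ι_injective (X : OneExtension M N) : Function.Injective X.ι :=
  X.shortExact.moduleCat_injective_f

lemma π_surjective (X : OneExtension M N) : Function.Surjective X.π :=
  X.shortExact.moduleCat_surjective_g

lemma exact (X : OneExtension M N) : Function.Exact X.ι X.π :=
  (ShortComplex.ShortExact.moduleCat_exact_iff_function_exact _).1 X.shortExact.exact

lemma zero_assoc (X : OneExtension M N) {K : ModuleCat.{v} D} (f : M ⟶ K) :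
    X.ι ≫ X.π ≫ f = 0 := by
  rw [← Category.assoc, X.zero, Limits.zero_comp]

lemma exists_lift (X : OneExtension M N) {K : ModuleCat.{v} D} (k : K ⟶ X.G)
    (h : k ≫ X.π = 0) : ∃ l : K ⟶ N, l ≫ X.ι = k :=
  have : Mono (ShortComplex.mk X.ι X.π X.zero).f := X.shortExact.mono_f
  ⟨X.shortExact.exact.lift k h, X.shortExact.exact.lift_f k h⟩

lemma exists_desc (X : OneExtension M N) {K : ModuleCat.{v} D} (k : X.G ⟶ K)
    (h : X.ι ≫ k = 0) : ∃ l : M ⟶ K, X.π ≫ l = k :=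
  have : Epi (ShortComplex.mk X.ι X.π X.zero).g := X.shortExact.epi_g
  ⟨X.shortExact.exact.desc k h, X.shortExact.exact.g_desc k h⟩

section ExtSequences

variable [Small.{v} D] (X : OneExtension M N) {K : ModuleCat.{v} D}

lemma cocycle_comp_ι : X.cocycle ▹ X.ι = 0 := X.shortExact.extClass_comp

lemma exists_comp_ι_eq {n : ℕ} (x : Ext K X.G n) (h : x ▹ X.π = 0) :
    ∃ ξ : Ext K N n, ξ ▹ X.ι = x :=
  Ext.covariant_sequence_exact₂ K X.shortExact x h

lemma comp_ι_eq_zero_iff (ξ : Ext K N 1) : ξ ▹ X.ι = 0 ↔ ξ ∈ homComp K X.cocycle := by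
  constructor
  · intro h
    obtain ⟨φ, hφ⟩ := Ext.covariant_sequence_exact₁ K X.shortExact ξ h (zero_add 1)
    obtain ⟨φ, rfl⟩ := (Ext.mk₀_bijective _ _).2 φ
    exact ⟨φ, hφ⟩
  · rintro ⟨φ, rfl⟩
    exact (Ext.comp_assoc_of_third_deg_zero _ X.cocycle _ (zero_add 1)).trans
      (by rw [cocycle_comp_ι, Ext.comp_zero])

lemma exists_comp_π_eq (φ : K ⟶ M) (h : φ ◃ X.cocycle = 0) : ∃ k : K ⟶ X.G, k ≫ X.π = φ := by
  obtain ⟨k, hk⟩ := Ext.covariant_sequence_exact₃ K X.shortExact (Ext.mk₀ φ) (zero_add 1) h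
  obtain ⟨k, rfl⟩ := (Ext.mk₀_bijective _ _).2 k
  exact ⟨k, (Ext.mk₀_bijective _ _).1 ((Ext.mk₀_comp_mk₀ k X.π).symm.trans hk)⟩

lemma exists_ι_comp_eq (ψ : N ⟶ K) (h : X.cocycle ▹ ψ = 0) : ∃ k : X.G ⟶ K, X.ι ≫ k = ψ := by
  obtain ⟨k, hk⟩ := Ext.contravariant_sequence_exact₁ X.shortExact K (Ext.mk₀ ψ) (add_zero 1) h
  obtain ⟨k, rfl⟩ := (Ext.mk₀_bijective _ _).2 k
  exact ⟨k, (Ext.mk₀_bijective _ _).1 ((Ext.mk₀_comp_mk₀ X.ι k).symm.trans hk)⟩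

end ExtSequences

/-- A morphism `0 ← M ← X.G ← N ← 0 ⟶ 0 ← M' ← Y.G ← N' ← 0` of `1`-extensions with prescribed
components `f : N ⟶ N'` and `g : M ⟶ M'` on the outer terms. -/
structure HomOver (X : OneExtension M N) (Y : OneExtension M' N') (f : N ⟶ N') (g : M ⟶ M') where
  hom : X.G ⟶ Y.G
  comm_ι : X.ι ≫ hom = f ≫ Y.ι
  comm_π : hom ≫ Y.π = X.π ≫ g

namespace HomOver

variable {X : OneExtension M N} {Y : OneExtension M' N'} {f : N ⟶ N'} {g : M ⟶ M'}

/-- The identity morphism. -/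
def id (X : OneExtension M N) : HomOver X X (𝟙 N) (𝟙 M) where
  hom := 𝟙 X.G
  comm_ι := by rw [Category.comp_id, Category.id_comp]
  comm_π := by rw [Category.comp_id, Category.id_comp]

/-- The underlying morphism of short complexes. -/
def toShortComplexHom (φ : HomOver X Y f g) :
    ShortComplex.mk X.ι X.π X.zero ⟶ ShortComplex.mk Y.ι Y.π Y.zero where
  τ₁ := f
  τ₂ := φ.hom
  τ₃ := g
  comm₁₂ := φ.comm_ι.symm
  comm₂₃ := φ.comm_π

lemma isIso_hom (φ : HomOver X Y f g) [IsIso f] [IsIso g] : IsIso φ.hom :=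
  have : IsIso φ.toShortComplexHom.τ₁ := ‹IsIso f›
  have : IsIso φ.toShortComplexHom.τ₃ := ‹IsIso g›
  ShortComplex.isIso₂_of_shortExact_of_isIso₁₃ φ.toShortComplexHom X.shortExact Y.shortExact

lemma cocycle_comp [Small.{v} D] (φ : HomOver X Y f g) : X.cocycle ▹ f = g ◃ Y.cocycle :=
  ShortComplex.ShortExact.extClass_naturality X.shortExact Y.shortExact φ.toShortComplexHom

end HomOver

lemma exists_homOver_left [Small.{v} D] (X : OneExtension M N) (Y : OneExtension M' N')
    (f : N ⟶ N') (h : X.cocycle ▹ (f ≫ Y.ι) = 0) :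
    ∃ g : M ⟶ M', Nonempty (HomOver X Y f g) := by
  obtain ⟨φ, hφ⟩ := X.exists_ι_comp_eq (f ≫ Y.ι) h
  obtain ⟨g, hg⟩ := X.exists_desc (φ ≫ Y.π) (by
    rw [← Category.assoc, hφ, Category.assoc, Y.zero, Limits.comp_zero])
  exact ⟨g, ⟨⟨φ, hφ, hg.symm⟩⟩⟩

theorem nonempty_homOver_iff [Small.{v} D] {X : OneExtension M N} {Y : OneExtension M' N'}
    {f : N ⟶ N'} {g : M ⟶ M'} :
    Nonempty (HomOver X Y f g) ↔ X.cocycle ▹ f = g ◃ Y.cocycle := by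
  refine ⟨fun ⟨φ⟩ => φ.cocycle_comp, fun h => ?_⟩
  obtain ⟨g', ⟨φ⟩⟩ := X.exists_homOver_left Y f (by
    rw [← comp_mk₀_comp_mk₀, h, Ext.comp_assoc_of_third_deg_zero, Y.cocycle_comp_ι, Ext.comp_zero])
  -- `g'` need not be `g`, but the difference lifts to `Y.G` and can be subtracted from `φ`.
  obtain ⟨k, hk⟩ := Y.exists_comp_π_eq (g' - g) (by
    rw [sub_eq_add_neg, Ext.mk₀_add, Ext.mk₀_neg, Ext.add_comp, Ext.neg_comp, ← φ.cocycle_comp, h,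
      add_neg_cancel])
  refine ⟨⟨φ.hom - X.π ≫ k, ?_, ?_⟩⟩
  · rw [Preadditive.comp_sub, X.zero_assoc, sub_zero, φ.comm_ι]
  · rw [Preadditive.sub_comp, φ.comm_π, Category.assoc, hk, Preadditive.comp_sub, sub_sub_cancel]

namespace Congruence

variable {X Y Z : OneExtension M N}

/-- The inverse congruence. -/
def symm (e : Congruence X Y) : Congruence Y X where
  iso := e.iso.symm
  comm_ι := by simp [← e.comm_ι]
  comm_π := by simp [← e.comm_π]

/-- The composite of two congruences. -/
def trans (e : Congruence X Y) (e' : Congruence Y Z) : Congruence X Z where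
  iso := e.iso ≪≫ e'.iso
  comm_ι := by rw [Iso.trans_hom, ← Category.assoc, e.comm_ι, e'.comm_ι]
  comm_π := by rw [Iso.trans_hom, Category.assoc, e'.comm_π, e.comm_π]

/-- A congruence as a morphism over the identities. -/
def toHomOver (e : Congruence X Y) : HomOver X Y (𝟙 N) (𝟙 M) where
  hom := e.iso.hom
  comm_ι := by rw [e.comm_ι, Category.id_comp]
  comm_π := by rw [e.comm_π, Category.comp_id]

/-- A morphism over identities is a congruence, by the five lemma. -/
def ofHomOver (φ : HomOver X Y (𝟙 N) (𝟙 M)) : Congruence X Y where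
  iso := have := φ.isIso_hom; asIso φ.hom
  comm_ι := by rw [asIso_hom, φ.comm_ι, Category.id_comp]
  comm_π := by rw [asIso_hom, φ.comm_π, Category.comp_id]

/-- The congruence `e + ψ`, where `ψ : M ⟶ N` is regarded as a map `X.G ⟶ Y.G`. -/
def addHom (e : Congruence X Y) (ψ : M ⟶ N) : Congruence X Y :=
  ofHomOver
    { hom := e.iso.hom + X.π ≫ ψ ≫ Y.ι
      comm_ι := by rw [Preadditive.comp_add, e.comm_ι, X.zero_assoc, add_zero, Category.id_comp]
      comm_π := by
        rw [Preadditive.add_comp, e.comm_π, Category.assoc, Category.assoc, Y.zero,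
          Limits.comp_zero, Limits.comp_zero, add_zero, Category.comp_id] }

lemma addHom_iso_hom (e : Congruence X Y) (ψ : M ⟶ N) :
    (e.addHom ψ).iso.hom = e.iso.hom + X.π ≫ ψ ≫ Y.ι := rfl

lemma exists_hom_eq_addHom (e e' : Congruence X Y) :
    ∃ ψ : M ⟶ N, e'.iso.hom = (e.addHom ψ).iso.hom := by
  obtain ⟨k, hk⟩ := Y.exists_lift (e'.iso.hom - e.iso.hom) (by
    rw [Preadditive.sub_comp, e.comm_π, e'.comm_π, sub_self])
  obtain ⟨ψ, hψ⟩ := X.exists_desc k (by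
    rw [← cancel_mono Y.ι, Category.assoc, hk, Preadditive.comp_sub, e.comm_ι, e'.comm_ι,
      sub_self, Limits.zero_comp])
  refine ⟨ψ, ?_⟩
  rw [addHom_iso_hom, ← Category.assoc, hψ, hk, add_sub_cancel]

end Congruence

lemma nonempty_congruence_iff [Small.{v} D] {X Y : OneExtension M N} :
    Nonempty (Congruence X Y) ↔ X.cocycle = Y.cocycle := by
  rw [← Ext.comp_mk₀_id X.cocycle, ← Ext.mk₀_id_comp Y.cocycle, ← nonempty_homOver_iff]
  exact ⟨Nonempty.map Congruence.toHomOver, Nonempty.map Congruence.ofHomOver⟩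

/-- The pullback of a `1`-extension along a linear map `g`, as a submodule of `M × Y.G`. -/
def pullback (Y : OneExtension M' N) (g : M ⟶ M') : OneExtension M N :=
  ofLinearMaps (M := M) (N := N)
    (G := ModuleCat.of D (LinearMap.eqLocus (g.hom ∘ₗ LinearMap.fst D M Y.G)
      (Y.π.hom ∘ₗ LinearMap.snd D M Y.G)))
    ((LinearMap.inr D M Y.G ∘ₗ Y.ι.hom).codRestrict _
      (fun n => ((map_zero g.hom).trans (Y.exact.apply_apply_eq_zero n).symm :)))
    (LinearMap.fst D M Y.G ∘ₗ Submodule.subtype _)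
    (fun _ _ h => Y.ι_injective (congrArg (fun z => z.1.2) h))
    (fun m => (Y.π_surjective (g m)).elim fun y hy => ⟨⟨(m, y), hy.symm⟩, rfl⟩)
    (by
      rintro ⟨⟨m, y⟩, h : g m = Y.π y⟩
      constructor
      · rintro (rfl : m = 0)
        obtain ⟨n, rfl⟩ := (Y.exact y).1 (h.symm.trans (map_zero g.hom))
        exact ⟨n, rfl⟩
      · rintro ⟨n, hn⟩
        exact (congrArg (fun z => z.1.1) hn).symm)

/-- The projection of the pullback onto `Y.G`. -/
def pullbackHom (Y : OneExtension M' N) (g : M ⟶ M') : HomOver (Y.pullback g) Y (𝟙 N) g where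
  hom := ModuleCat.ofHom (LinearMap.snd D M Y.G ∘ₗ Submodule.subtype _)
  comm_ι := rfl
  comm_π := by ext z; exact z.2.symm

lemma pullback_cocycle [Small.{v} D] (Y : OneExtension M' N) (g : M ⟶ M') :
    (Y.pullback g).cocycle = g ◃ Y.cocycle := by
  rw [← (Y.pullbackHom g).cocycle_comp, Ext.comp_mk₀_id]

/-- The `1`-extension of `N` given by an embedding into an injective module. -/
def injectiveEmbedding (N : ModuleCat.{v} D) [Small.{v} D] :
    OneExtension (Limits.cokernel (Injective.ι N)) N where
  G := Injective.under N
  ι := Injective.ι N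
  π := Limits.cokernel.π _
  zero := Limits.cokernel.condition _
  shortExact := { exact := ShortComplex.exact_cokernel _ }

theorem exists_cocycle_eq [Small.{v} D] (x : Ext M N 1) :
    ∃ X : OneExtension M N, X.cocycle = x := by
  let Y := injectiveEmbedding N
  obtain ⟨g, hg⟩ : x ∈ homComp M Y.cocycle :=
    (Y.comp_ι_eq_zero_iff x).1 (Ext.eq_zero_of_injective (I := Injective.under N) _)
  exact ⟨Y.pullback g, (Y.pullback_cocycle g).trans hg⟩

end OneExtension

namespace TwoExtensionModule

variable {D : Type u} [Ring D] {M L N M' L' N' : ModuleCat.{v} D}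

/-- The inclusion `E₁ ⟶ E`. -/
def incl (A : TwoExtensionModule M L N) : A.G₁.G ⟶ A.E := ModuleCat.ofHom A.E₁.subtype

/-- The projection `E ⟶ E / E₂`. -/
def proj (A : TwoExtensionModule M L N) : A.E ⟶ A.G₀.G := ModuleCat.ofHom A.E₂.mkQ

/-- The `1`-extension `A.upper`, with its end and its maps expressed through `A.G₀` and `A.G₁`. -/
abbrev pushExtension (A : TwoExtensionModule M L N) : OneExtension M A.G₁.G where
  G := A.E
  ι := A.incl
  π := A.proj ≫ A.G₀.π
  zero := A.upper.zero
  shortExact := A.upper.shortExact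

/-- The `1`-extension `A.lower`, with its end and its maps expressed through `A.G₀` and `A.G₁`. -/
abbrev pullExtension (A : TwoExtensionModule M L N) : OneExtension A.G₀.G N where
  G := A.E
  ι := A.G₁.ι ≫ A.incl
  π := A.proj
  zero := A.lower.zero
  shortExact := A.lower.shortExact

instance (A : TwoExtensionModule M L N) : Mono A.incl := A.pushExtension.shortExact.mono_f

instance (A : TwoExtensionModule M L N) : Epi A.proj := A.pullExtension.shortExact.epi_g

lemma G₀_ι_grL (A : TwoExtensionModule M L N) (z : A.E₁) :
    A.G₀.ι (A.grL (Submodule.Quotient.mk z)) = A.proj z.1 :=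
  congrArg ((A.E₂.comap A.E₁.subtype).mapQ A.E₂ A.E₁.subtype le_rfl)
    (A.grL.symm_apply_apply (Submodule.Quotient.mk z))

lemma pullExtension_ι_grN (A : TwoExtensionModule M L N) (z : A.E₂) :
    A.pullExtension.ι (A.grN z) = z.1 :=
  congrArg Subtype.val (A.grN.symm_apply_apply z)

lemma incl_proj (A : TwoExtensionModule M L N) : A.incl ≫ A.proj = A.G₁.π ≫ A.G₀.ι := by
  ext z
  exact (A.G₀_ι_grL z).symm

lemma mem_E₁_iff (A : TwoExtensionModule M L N) (e : A.E) :
    e ∈ A.E₁ ↔ A.G₀.π (A.proj e) = 0 :=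
  ((A.grM.map_eq_zero_iff).trans (Submodule.Quotient.mk_eq_zero A.E₁)).symm

lemma mem_E₂_iff (A : TwoExtensionModule M L N) (e : A.E) : e ∈ A.E₂ ↔ A.proj e = 0 :=
  (Submodule.Quotient.mk_eq_zero A.E₂).symm

/-- A morphism of `2`-extension modules, preserving the filtrations and with prescribed components
on the subfactors. The maps on `E₁` and `E / E₂` which `mid : E ⟶ E'` induces are part of the
data. -/
structure FilteredHom (A : TwoExtensionModule M L N) (B : TwoExtensionModule M' L' N')
    (f : N ⟶ N') (h : L ⟶ L') (g : M ⟶ M') where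
  sub : OneExtension.HomOver A.G₁ B.G₁ f h
  mid : A.E ⟶ B.E
  quot : OneExtension.HomOver A.G₀ B.G₀ h g
  incl_mid : A.incl ≫ mid = sub.hom ≫ B.incl
  mid_proj : mid ≫ B.proj = A.proj ≫ quot.hom

namespace FilteredHom

variable {A : TwoExtensionModule M L N} {B : TwoExtensionModule M' L' N'}
  {f : N ⟶ N'} {h : L ⟶ L'} {g : M ⟶ M'}

/-- The morphism of the extensions `0 ← M ← E ← E₁ ← 0`. -/
def toPush (φ : FilteredHom A B f h g) :
    OneExtension.HomOver A.pushExtension B.pushExtension φ.sub.hom g where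
  hom := φ.mid
  comm_ι := φ.incl_mid
  comm_π := by
    rw [← Category.assoc, φ.mid_proj, Category.assoc, φ.quot.comm_π, Category.assoc]

/-- The morphism of the extensions `0 ← E / E₂ ← E ← N ← 0`. -/
def toPull (φ : FilteredHom A B f h g) :
    OneExtension.HomOver A.pullExtension B.pullExtension f φ.quot.hom where
  hom := φ.mid
  comm_ι := by
    rw [Category.assoc, φ.incl_mid, ← Category.assoc, φ.sub.comm_ι, Category.assoc]
  comm_π := φ.mid_proj

lemma nonempty_of_push (c : OneExtension.HomOver A.G₁ B.G₁ f h)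
    (φ : OneExtension.HomOver A.pushExtension B.pushExtension c.hom g) :
    Nonempty (FilteredHom A B f h g) := by
  have incl_φ : A.incl ≫ φ.hom ≫ B.proj = A.G₁.π ≫ h ≫ B.G₀.ι := by
    rw [← Category.assoc, φ.comm_ι, Category.assoc, B.incl_proj, ← Category.assoc, c.comm_π,
      Category.assoc]
  obtain ⟨q, hq⟩ := A.pullExtension.exists_desc (φ.hom ≫ B.proj) (by
    rw [Category.assoc, incl_φ, A.G₁.zero_assoc])
  refine ⟨⟨c, φ.hom, ⟨q, ?_, ?_⟩, φ.comm_ι, hq.symm⟩⟩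
  · rw [← cancel_epi A.G₁.π, ← incl_φ, ← hq, ← Category.assoc, ← A.incl_proj, Category.assoc]
  · rw [← cancel_epi A.proj, ← Category.assoc, hq, Category.assoc, φ.comm_π, Category.assoc]

lemma nonempty_of_pull (c : OneExtension.HomOver A.G₀ B.G₀ h g)
    (φ : OneExtension.HomOver A.pullExtension B.pullExtension f c.hom) :
    Nonempty (FilteredHom A B f h g) := by
  have φ_proj : (A.incl ≫ φ.hom) ≫ B.proj = A.G₁.π ≫ h ≫ B.G₀.ι := by
    rw [Category.assoc, φ.comm_π, ← Category.assoc, A.incl_proj, Category.assoc, c.comm_ι]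
  obtain ⟨s, hs⟩ := B.pushExtension.exists_lift (A.incl ≫ φ.hom) (by
    rw [← Category.assoc, φ_proj, Category.assoc, Category.assoc, B.G₀.zero, Limits.comp_zero,
      Limits.comp_zero])
  refine ⟨⟨⟨s, ?_, ?_⟩, φ.hom, c, hs.symm, φ.comm_π⟩⟩
  · rw [← cancel_mono B.incl, Category.assoc, hs, ← Category.assoc, φ.comm_ι, Category.assoc]
  · rw [← cancel_mono B.G₀.ι, Category.assoc, ← B.incl_proj, ← Category.assoc, hs, φ_proj,
      Category.assoc]

variable [Small.{v} D]

theorem nonempty_iff_push : Nonempty (FilteredHom A B f h g) ↔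
    ∃ c : OneExtension.HomOver A.G₁ B.G₁ f h,
      A.pushExtension.cocycle ▹ c.hom = g ◃ B.pushExtension.cocycle := by
  constructor
  · rintro ⟨φ⟩
    exact ⟨φ.sub, φ.toPush.cocycle_comp⟩
  · rintro ⟨c, hc⟩
    obtain ⟨φ⟩ := OneExtension.nonempty_homOver_iff.2 hc
    exact nonempty_of_push c φ

theorem nonempty_iff_pull : Nonempty (FilteredHom A B f h g) ↔
    ∃ c : OneExtension.HomOver A.G₀ B.G₀ h g,
      A.pullExtension.cocycle ▹ f = c.hom ◃ B.pullExtension.cocycle := by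
  constructor
  · rintro ⟨φ⟩
    exact ⟨φ.quot, φ.toPull.cocycle_comp⟩
  · rintro ⟨c, hc⟩
    obtain ⟨φ⟩ := OneExtension.nonempty_homOver_iff.2 hc
    exact nonempty_of_pull c φ

end FilteredHom

section FilteredIso

variable {A B : TwoExtensionModule M L N}

/-- The map which a filtered isomorphism induces on the `1`-extensions `0 ← L ← E₁ ← N ← 0`. -/
def FilteredIso.restrict (φ : FilteredIso A B) : OneExtension.HomOver A.G₁ B.G₁ (𝟙 N) (𝟙 L) where
  hom := ModuleCat.ofHom ((φ.α.toLinearMap ∘ₗ A.E₁.subtype).codRestrict B.E₁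
    fun z => (φ.mem₁ _).2 z.2)
  comm_ι := by
    ext n
    obtain ⟨z, rfl⟩ := A.grN.surjective n
    refine Subtype.ext ((congrArg φ.α (A.pullExtension_ι_grN z)).trans ?_)
    exact (B.pullExtension_ι_grN _).symm.trans (congrArg B.pullExtension.ι (φ.grN_eq z.1 z.2))
  comm_π := by
    ext z
    exact φ.grL_eq z.1 z.2

lemma FilteredIso.nonempty_filteredHom (φ : FilteredIso A B) :
    Nonempty (FilteredHom A B (𝟙 N) (𝟙 L) (𝟙 M)) :=
  FilteredHom.nonempty_of_push φ.restrict
    { hom := ModuleCat.ofHom φ.α.toLinearMap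
      comm_ι := rfl
      comm_π := by ext e; exact φ.grM_eq e }

lemma FilteredHom.nonempty_filteredIso (φ : FilteredHom A B (𝟙 N) (𝟙 L) (𝟙 M)) :
    Nonempty (FilteredIso A B) := by
  have : IsIso φ.sub.hom := φ.sub.isIso_hom
  have : IsIso φ.mid := φ.toPush.isIso_hom
  have : IsIso φ.quot.hom := φ.quot.isIso_hom
  have mid_proj (e : A.E) : B.proj (φ.mid e) = φ.quot.hom (A.proj e) :=
    ConcreteCategory.congr_hom φ.mid_proj e
  have mid_π (e : A.E) : B.G₀.π (B.proj (φ.mid e)) = A.G₀.π (A.proj e) :=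
    ConcreteCategory.congr_hom φ.toPush.comm_π e
  have quot_ι (l : L) : φ.quot.hom (A.G₀.ι l) = B.G₀.ι l :=
    ConcreteCategory.congr_hom φ.quot.comm_ι l
  have mid_ι (n : N) : φ.mid (A.pullExtension.ι n) = B.pullExtension.ι n :=
    ConcreteCategory.congr_hom φ.toPull.comm_ι n
  have quot_injective : Function.Injective φ.quot.hom :=
    (ModuleCat.mono_iff_injective _).1 inferInstance
  exact ⟨{
    α := (asIso φ.mid).toLinearEquiv
    mem₁ := fun e => by
      rw [mem_E₁_iff, mem_E₁_iff, ← mid_π]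
      rfl
    mem₂ := fun e => by
      rw [mem_E₂_iff, mem_E₂_iff, ← map_eq_zero_iff φ.quot.hom.hom quot_injective]
      exact Eq.congr_left (mid_proj e)
    grM_eq := mid_π
    grL_eq := fun e he => B.G₀.ι_injective (by
      rw [G₀_ι_grL, ← quot_ι, G₀_ι_grL]
      exact mid_proj e)
    grN_eq := fun e he => B.pullExtension.ι_injective (by
      rw [pullExtension_ι_grN, ← mid_ι, pullExtension_ι_grN]
      rfl) }⟩

theorem nonempty_filteredIso_iff :
    Nonempty (FilteredIso A B) ↔ Nonempty (FilteredHom A B (𝟙 N) (𝟙 L) (𝟙 M)) :=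
  ⟨fun ⟨φ⟩ => φ.nonempty_filteredHom, fun ⟨φ⟩ => φ.nonempty_filteredIso⟩

variable [Small.{v} D]

lemma inducedByPush_iff {G₁ : OneExtension L N} {x : Ext M G₁.G 1} :
    InducedByPush G₁ A x ↔
      ∃ c : OneExtension.HomOver G₁ A.G₁ (𝟙 N) (𝟙 L), x ▹ c.hom = A.pushExtension.cocycle :=
  ⟨fun ⟨e, he⟩ => ⟨e.toHomOver, he⟩, fun ⟨c, hc⟩ => ⟨.ofHomOver c, hc⟩⟩

lemma inducedByPull_iff {G₀ : OneExtension M L} {y : Ext G₀.G N 1} :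
    InducedByPull G₀ A y ↔
      ∃ c : OneExtension.HomOver A.G₀ G₀ (𝟙 L) (𝟙 M), c.hom ◃ y = A.pullExtension.cocycle :=
  ⟨fun ⟨e, he⟩ => ⟨e.toHomOver, he⟩, fun ⟨c, hc⟩ => ⟨.ofHomOver c, hc⟩⟩

theorem nonempty_filteredIso_iff_push :
    Nonempty (FilteredIso A B) ↔ InducedByPush A.G₁ B A.pushExtension.cocycle := by
  rw [nonempty_filteredIso_iff, FilteredHom.nonempty_iff_push, inducedByPush_iff]
  simp only [Ext.mk₀_id_comp]

theorem nonempty_filteredIso_iff_pull :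
    Nonempty (FilteredIso A B) ↔ InducedByPull B.G₀ A B.pullExtension.cocycle := by
  rw [nonempty_filteredIso_iff, FilteredHom.nonempty_iff_pull, inducedByPull_iff]
  simp only [Ext.comp_mk₀_id, eq_comm]

lemma pushExtension_cocycle_comp_π (A : TwoExtensionModule M L N) :
    A.pushExtension.cocycle ▹ A.G₁.π = A.G₀.cocycle := by
  have φ : OneExtension.HomOver A.pushExtension A.G₀ A.G₁.π (𝟙 M) :=
    { hom := A.proj, comm_ι := A.incl_proj, comm_π := (Category.comp_id _).symm }
  rw [φ.cocycle_comp, Ext.mk₀_id_comp]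

lemma ι_comp_pullExtension_cocycle (A : TwoExtensionModule M L N) :
    A.G₀.ι ◃ A.pullExtension.cocycle = A.G₁.cocycle := by
  have φ : OneExtension.HomOver A.G₁ A.pullExtension (𝟙 N) A.G₀.ι :=
    { hom := A.incl, comm_ι := (Category.id_comp _).symm, comm_π := A.incl_proj }
  rw [← φ.cocycle_comp, Ext.comp_mk₀_id]

lemma pullExtension_cocycle_comp_ι (A : TwoExtensionModule M L N) :
    A.pullExtension.cocycle ▹ A.G₁.ι = A.G₀.π ◃ A.pushExtension.cocycle := by
  have φ : OneExtension.HomOver A.pullExtension A.pushExtension A.G₁.ι A.G₀.π :=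
    { hom := 𝟙 A.E, comm_ι := Category.comp_id _, comm_π := Category.id_comp _ }
  exact φ.cocycle_comp

end FilteredIso

end TwoExtensionModule

/-- The `2`-extension module on `E` given by a surjection `q : E → M`, a surjection
`l : ker q → L` and an injection `j : N → E` whose image is the kernel of `l`. -/
def TwoExtensionModule.ofLinearMaps {D : Type u} [Ring D] {M L N : ModuleCat.{v} D}
    (E : ModuleCat.{v} D) (j : N →ₗ[D] E) (q : E →ₗ[D] M) (l : LinearMap.ker q →ₗ[D] L)
    (hj : Function.Injective j) (hq : Function.Surjective q) (hl : Function.Surjective l)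
    (hjq : ∀ n, q (j n) = 0) (hjl : ∀ z, l z = 0 ↔ z.1 ∈ LinearMap.range j) :
    TwoExtensionModule M L N where
  E := E
  E₁ := LinearMap.ker q
  E₂ := LinearMap.range j
  le := by rintro _ ⟨n, rfl⟩; exact hjq n
  grM := q.quotKerEquivOfSurjective hq
  grL := (Submodule.quotEquivOfEq _ _ (by ext z; exact (hjl z).symm)).trans
    (l.quotKerEquivOfSurjective hl)
  grN := (LinearEquiv.ofInjective j hj).symm

namespace OneExtension

variable {D : Type u} [Ring D] {M L N M' N' K : ModuleCat.{v} D}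

/-- The isomorphism of `N` with the kernel of `X.π`. -/
def kerEquiv (X : OneExtension M N) : N ≃ₗ[D] LinearMap.ker X.π.hom :=
  LinearEquiv.ofBijective (X.ι.hom.codRestrict _ X.exact.apply_apply_eq_zero)
    ⟨fun _ _ h => X.ι_injective (congrArg Subtype.val h), fun z =>
      ((X.exact z.1).1 z.2).imp fun _ => Subtype.ext⟩

lemma ι_kerEquiv_symm (X : OneExtension M N) (z : LinearMap.ker X.π.hom) :
    X.ι (X.kerEquiv.symm z) = z.1 :=
  congrArg Subtype.val (X.kerEquiv.apply_symm_apply z)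

/-- The `2`-extension module on `X.G` given by an extension `X` of `M` by the middle term of `G₁`,
with `E₁ ≅ G₁`. -/
def push (G₁ : OneExtension L N) (X : OneExtension M G₁.G) : TwoExtensionModule M L N :=
  .ofLinearMaps X.G (X.ι.hom ∘ₗ G₁.ι.hom) X.π.hom (G₁.π.hom ∘ₗ X.kerEquiv.symm.toLinearMap)
    (X.ι_injective.comp G₁.ι_injective) X.π_surjective
    (G₁.π_surjective.comp X.kerEquiv.symm.surjective) (fun _ => X.exact.apply_apply_eq_zero _)
    (fun z => (G₁.exact _).trans (exists_congr fun n => by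
      rw [← X.ι_kerEquiv_symm z]
      exact X.ι_injective.eq_iff.symm))

/-- The `2`-extension module on `Y.G` given by an extension `Y` of the middle term of `G₀` by `N`,
with `E / E₂ ≅ G₀`. -/
def pull (G₀ : OneExtension M L) (Y : OneExtension G₀.G N) : TwoExtensionModule M L N :=
  .ofLinearMaps Y.G Y.ι.hom (G₀.π.hom ∘ₗ Y.π.hom)
    (G₀.kerEquiv.symm.toLinearMap ∘ₗ (Y.π.hom ∘ₗ Submodule.subtype _).codRestrict
      (LinearMap.ker G₀.π.hom) (fun z => z.2))
    Y.ι_injective (G₀.π_surjective.comp Y.π_surjective)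
    (G₀.kerEquiv.symm.surjective.comp fun z => (Y.π_surjective z.1).elim fun y hy =>
      ⟨⟨y, (congrArg G₀.π hy).trans z.2⟩, Subtype.ext hy⟩)
    (fun n => (congrArg G₀.π (Y.exact.apply_apply_eq_zero n)).trans (map_zero G₀.π.hom))
    (fun z => G₀.kerEquiv.symm.map_eq_zero_iff.trans (Subtype.ext_iff.trans (Y.exact z.1)))

/-- The direct sum of a `1`-extension `0 ← M ← X.G ← N ← 0` and `0 ← 0 ← K ← K ← 0`. -/
def addSummand (X : OneExtension M N) (K : ModuleCat.{v} D) :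
    OneExtension M (ModuleCat.of D (N × K)) :=
  ofLinearMaps (N := ModuleCat.of D (N × K)) (G := ModuleCat.of D (X.G × K))
    (X.ι.hom.prodMap LinearMap.id) (X.π.hom ∘ₗ LinearMap.fst D X.G K)
    (X.ι_injective.prodMap Function.injective_id) (X.π_surjective.comp Prod.fst_surjective)
    (fun z => (X.exact z.1).trans
      ⟨fun ⟨n, hn⟩ => ⟨(n, z.2), Prod.ext hn rfl⟩, fun ⟨n, hn⟩ => ⟨n.1, congrArg Prod.fst hn⟩⟩)

/-- The map on the middle term `X.G × K` of `X.addSummand K` with components `a` and `b`. -/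
def addSummandDesc (X : OneExtension M N) {P : ModuleCat.{v} D} (a : X.G ⟶ P) (b : K ⟶ P) :
    (X.addSummand K).G ⟶ P :=
  ModuleCat.ofHom (a.hom.coprod b.hom)

lemma addSummand_ι_desc (X : OneExtension M N) {P : ModuleCat.{v} D} (a : X.G ⟶ P) (b : K ⟶ P) :
    (X.addSummand K).ι ≫ X.addSummandDesc a b =
      ModuleCat.ofHom ((X.ι ≫ a).hom.coprod b.hom) := rfl

/-- The morphism from `X.addSummand K` with components `φ` on `X` and `ψ` on `K`. -/
def HomOver.coprod {X : OneExtension M N} {Y : OneExtension M' N'} {f : N ⟶ N'} {g : M ⟶ M'}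
    (φ : HomOver X Y f g) (ψ : K ⟶ N') :
    HomOver (X.addSummand K) Y (ModuleCat.ofHom (f.hom.coprod ψ.hom)) g where
  hom := X.addSummandDesc φ.hom (ψ ≫ Y.ι)
  comm_ι := by
    rw [addSummand_ι_desc, φ.comm_ι]
    exact ModuleCat.hom_ext (LinearMap.comp_coprod Y.ι.hom f.hom ψ.hom).symm
  comm_π := by
    refine ModuleCat.hom_ext (LinearMap.ext fun z => ?_)
    have h₁ := ConcreteCategory.congr_hom φ.comm_π z.1
    have h₂ : Y.π (Y.ι (ψ z.2)) = 0 := Y.exact.apply_apply_eq_zero _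
    exact (map_add Y.π.hom _ _).trans ((congrArg₂ (· + ·) h₁ h₂).trans (add_zero _))

variable [Small.{v} D]

lemma exists_ext_comp_addSummandDesc (X : OneExtension M N) {P : ModuleCat.{v} D}
    (x : Ext P X.G 1) (ξ : Ext P K 1) : ∃ z : Ext P (X.addSummand K).G 1,
      ∀ {Q : ModuleCat.{v} D} (a : X.G ⟶ Q) (b : K ⟶ Q),
        z ▹ X.addSummandDesc a b = x ▹ a + ξ ▹ b := by
  let inl : X.G ⟶ (X.addSummand K).G := ModuleCat.ofHom (LinearMap.inl D X.G K)
  let inr : K ⟶ (X.addSummand K).G := ModuleCat.ofHom (LinearMap.inr D X.G K)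
  refine ⟨x ▹ inl + ξ ▹ inr, fun a b => ?_⟩
  have inl_desc : inl ≫ X.addSummandDesc a b = a :=
    ModuleCat.hom_ext (LinearMap.coprod_inl a.hom b.hom)
  have inr_desc : inr ≫ X.addSummandDesc a b = b :=
    ModuleCat.hom_ext (LinearMap.coprod_inr a.hom b.hom)
  rw [Ext.add_comp, comp_mk₀_comp_mk₀, comp_mk₀_comp_mk₀, inl_desc, inr_desc]

theorem inducedByPush_push (G₁ : OneExtension L N) (X : OneExtension M G₁.G) :
    InducedByPush G₁ (G₁.push X) X.cocycle := by
  let c : HomOver G₁ (G₁.push X).G₁ (𝟙 N) (𝟙 L) :=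
    { hom := ModuleCat.ofHom X.kerEquiv.toLinearMap
      comm_ι := rfl
      comm_π := by ext z; exact congrArg G₁.π (X.kerEquiv.symm_apply_apply z) }
  have φ : HomOver X (G₁.push X).pushExtension c.hom (𝟙 M) :=
    { hom := 𝟙 X.G, comm_ι := rfl, comm_π := rfl }
  exact TwoExtensionModule.inducedByPush_iff.2
    ⟨c, φ.cocycle_comp.trans (Ext.mk₀_id_comp _)⟩

theorem inducedByPull_pull (G₀ : OneExtension M L) (Y : OneExtension G₀.G N) :
    InducedByPull G₀ (G₀.pull Y) Y.cocycle := by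
  let A := G₀.pull Y
  let p : A.E ⧸ A.E₂ →ₗ[D] G₀.G := A.E₂.liftQ Y.π.hom
    (LinearMap.range_le_ker_iff.2 (LinearMap.ext Y.exact.apply_apply_eq_zero))
  let c : HomOver A.G₀ G₀ (𝟙 L) (𝟙 M) :=
    { hom := ModuleCat.ofHom p
      comm_ι := by
        ext l
        obtain ⟨z, rfl⟩ := A.grL.surjective l
        obtain ⟨z, rfl⟩ := Submodule.Quotient.mk_surjective _ z
        exact (congrArg p (A.G₀_ι_grL z)).trans (G₀.ι_kerEquiv_symm ⟨Y.π z.1, z.2⟩).symm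
      comm_π := by
        ext z
        obtain ⟨z, rfl⟩ := Submodule.Quotient.mk_surjective _ z
        rfl }
  have φ : HomOver A.pullExtension Y (𝟙 N) c.hom :=
    { hom := 𝟙 Y.G, comm_ι := rfl, comm_π := rfl }
  exact TwoExtensionModule.inducedByPull_iff.2
    ⟨c, φ.cocycle_comp.symm.trans (Ext.comp_mk₀_id _)⟩

theorem exists_inducedByPush (G₁ : OneExtension L N) (x : Ext M G₁.G 1) :
    ∃ A : TwoExtensionModule M L N, InducedByPush G₁ A x := by
  obtain ⟨X, rfl⟩ := exists_cocycle_eq x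
  exact ⟨_, G₁.inducedByPush_push X⟩

theorem exists_inducedByPull (G₀ : OneExtension M L) (y : Ext G₀.G N 1) :
    ∃ A : TwoExtensionModule M L N, InducedByPull G₀ A y := by
  obtain ⟨Y, rfl⟩ := exists_cocycle_eq y
  exact ⟨_, G₀.inducedByPull_pull Y⟩

end OneExtension

namespace OneExtension.Congruence

variable {D : Type u} [Ring D] [Small.{v} D] {M N K : ModuleCat.{v} D} {X Y : OneExtension M N}

lemma comp_hom_comp_inv (e : Congruence X Y) (x : Ext K X.G 1) :
    (x ▹ e.iso.hom) ▹ e.iso.inv = x := by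
  rw [comp_mk₀_comp_mk₀, Iso.hom_inv_id, Ext.comp_mk₀_id]

lemma comp_hom_injective (e : Congruence X Y) :
    Function.Injective fun x : Ext K X.G 1 => x ▹ e.iso.hom := fun x x' h =>
  (e.comp_hom_comp_inv x).symm.trans
    ((congrArg (· ▹ e.iso.inv) h).trans (e.comp_hom_comp_inv x'))

lemma hom_comp_injective (e : Congruence X Y) :
    Function.Injective fun y : Ext Y.G K 1 => e.iso.hom ◃ y := fun y y' h => by
  simpa only [Ext.mk₀_comp_mk₀_assoc, Iso.inv_hom_id, Ext.mk₀_id_comp] using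
    congrArg (fun z => e.iso.inv ◃ z) h

end OneExtension.Congruence

section Induced

variable {D : Type u} [Ring D] [Small.{v} D] {M L N M' L' N' K : ModuleCat.{v} D}
  {A B : TwoExtensionModule M L N}

open OneExtension TwoExtensionModule

namespace InducedByPush

variable {G₁ G₁' : OneExtension L N} {x : Ext M G₁.G 1}

lemma refl (A : TwoExtensionModule M L N) : InducedByPush A.G₁ A A.pushExtension.cocycle :=
  nonempty_filteredIso_iff_push.1 ⟨.refl A⟩

lemma iff_of_congruence (e : Congruence G₁ G₁') :
    InducedByPush G₁ A x ↔ InducedByPush G₁' A (x ▹ e.iso.hom) := by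
  constructor
  · rintro ⟨c, hc⟩
    refine ⟨e.symm.trans c, ?_⟩
    rw [← hc, comp_mk₀_comp_mk₀]
    exact congrArg (x ▹ ·) (Iso.hom_inv_id_assoc e.iso c.iso.hom)
  · rintro ⟨c, hc⟩
    exact ⟨e.trans c, (comp_mk₀_comp_mk₀ ..).symm.trans hc⟩

lemma comp_π (h : InducedByPush G₁ A x) : x ▹ G₁.π = A.G₀.cocycle := by
  obtain ⟨c, hc⟩ := inducedByPush_iff.1 h
  rw [← A.pushExtension_cocycle_comp_π, ← hc, comp_mk₀_comp_mk₀, c.comm_π, Category.comp_id]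

lemma cocycle_eq (h : InducedByPush G₁ A x) : G₁.cocycle = A.G₁.cocycle :=
  nonempty_congruence_iff.1 ⟨h.choose⟩

lemma exists_of_cocycle_eq (h : G₁.cocycle = A.G₁.cocycle) : ∃ x, InducedByPush G₁ A x := by
  obtain ⟨e⟩ := nonempty_congruence_iff.2 h.symm
  exact ⟨_, (iff_of_congruence e).1 (refl A)⟩

theorem iff_nonempty_filteredIso (h : InducedByPush G₁ A x) :
    InducedByPush G₁ B x ↔ Nonempty (FilteredIso A B) := by
  obtain ⟨e, he : _ = A.pushExtension.cocycle⟩ := h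
  rw [nonempty_filteredIso_iff_push, ← he, iff_of_congruence e]

lemma nonempty_filteredHom {A : TwoExtensionModule M L N} {B : TwoExtensionModule M' L' N'}
    {G : OneExtension L N} {G' : OneExtension L' N'} {x : Ext M G.G 1} {x' : Ext M' G'.G 1}
    {f : N ⟶ N'} {h : L ⟶ L'} {g : M ⟶ M'} (hA : InducedByPush G A x)
    (hB : InducedByPush G' B x') (c : HomOver G G' f h) (hc : x ▹ c.hom = g ◃ x') :
    Nonempty (FilteredHom A B f h g) := by
  obtain ⟨a, ha : _ = A.pushExtension.cocycle⟩ := hA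
  obtain ⟨b, hb : _ = B.pushExtension.cocycle⟩ := hB
  refine FilteredHom.nonempty_iff_push.2 ⟨⟨a.symm.iso.hom ≫ c.hom ≫ b.iso.hom, ?_, ?_⟩, ?_⟩
  · rw [← Category.assoc, a.symm.comm_ι, ← Category.assoc, c.comm_ι, Category.assoc, b.comm_ι]
  · rw [Category.assoc, Category.assoc, b.comm_π, c.comm_π, ← Category.assoc, a.symm.comm_π]
  · rw [← comp_mk₀_comp_mk₀, ← comp_mk₀_comp_mk₀, ← ha, ← hb]
    exact (congrArg (fun z => (z ▹ c.hom) ▹ b.iso.hom) (a.comp_hom_comp_inv x)).trans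
      ((congrArg (· ▹ b.iso.hom) hc).trans (Ext.comp_assoc_of_third_deg_zero ..))

lemma pullExtension_cocycle_comp (h : InducedByPush G₁ A x) (r : G₁.G ⟶ K) :
    A.pullExtension.cocycle ▹ (G₁.ι ≫ r) = A.G₀.π ◃ (x ▹ r) := by
  obtain ⟨e, he : _ = A.pushExtension.cocycle⟩ := h
  rw [← e.symm.comm_ι, Category.assoc, ← comp_mk₀_comp_mk₀, pullExtension_cocycle_comp_ι, ← he,
    Ext.comp_assoc_of_third_deg_zero, ← comp_mk₀_comp_mk₀]
  exact congrArg (fun z => A.G₀.π ◃ (z ▹ r)) (e.comp_hom_comp_inv x)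

end InducedByPush

namespace InducedByPull

variable {G₀ G₀' : OneExtension M L} {y : Ext G₀.G N 1}

lemma refl (A : TwoExtensionModule M L N) : InducedByPull A.G₀ A A.pullExtension.cocycle :=
  nonempty_filteredIso_iff_pull.1 ⟨.refl A⟩

lemma iff_of_congruence (e : Congruence G₀' G₀) :
    InducedByPull G₀ A y ↔ InducedByPull G₀' A (e.iso.hom ◃ y) := by
  constructor
  · rintro ⟨c, hc⟩
    refine ⟨c.trans e.symm, ?_⟩
    rw [← hc, Ext.mk₀_comp_mk₀_assoc]
    exact congrArg (· ◃ y) ((Category.assoc ..).trans (by simp [Congruence.symm]))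
  · rintro ⟨c, hc⟩
    exact ⟨c.trans e, (Ext.mk₀_comp_mk₀_assoc ..).symm.trans hc⟩

lemma ι_comp (h : InducedByPull G₀ A y) : G₀.ι ◃ y = A.G₁.cocycle := by
  obtain ⟨c, hc⟩ := inducedByPull_iff.1 h
  rw [← A.ι_comp_pullExtension_cocycle, ← hc, Ext.mk₀_comp_mk₀_assoc, c.comm_ι, Category.id_comp]

lemma cocycle_eq (h : InducedByPull G₀ A y) : A.G₀.cocycle = G₀.cocycle :=
  nonempty_congruence_iff.1 ⟨h.choose⟩

lemma exists_of_cocycle_eq (h : A.G₀.cocycle = G₀.cocycle) : ∃ y, InducedByPull G₀ A y := by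
  obtain ⟨e⟩ := nonempty_congruence_iff.2 h.symm
  exact ⟨_, (iff_of_congruence e).1 (refl A)⟩

theorem iff_nonempty_filteredIso (h : InducedByPull G₀ A y) :
    InducedByPull G₀ B y ↔ Nonempty (FilteredIso A B) := by
  have symm_iff : Nonempty (FilteredIso A B) ↔ Nonempty (FilteredIso B A) :=
    ⟨Nonempty.map .symm, Nonempty.map .symm⟩
  obtain ⟨e, he : _ = A.pullExtension.cocycle⟩ := h
  rw [symm_iff, nonempty_filteredIso_iff_pull, ← he, iff_of_congruence e]

end InducedByPull

namespace TwoExtensionModule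

/-- `B` arises from `A` by the action of `ξ` on extensions of `M` by `E₁`. -/
def IsTranslate (ξ : Ext M N 1) (A B : TwoExtensionModule M L N) : Prop :=
  InducedByPush A.G₁ B (ξ ▹ A.G₁.ι + A.pushExtension.cocycle)

end TwoExtensionModule

theorem InducedByPush.isTranslate_iff {G₁ : OneExtension L N} {x : Ext M G₁.G 1} {ξ : Ext M N 1}
    (h : InducedByPush G₁ A x) : IsTranslate ξ A B ↔ InducedByPush G₁ B (ξ ▹ G₁.ι + x) := by
  obtain ⟨e, he : _ = A.pushExtension.cocycle⟩ := h
  rw [iff_of_congruence e, Ext.add_comp, comp_mk₀_comp_mk₀, e.comm_ι, he, IsTranslate]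

namespace TwoExtensionModule.IsTranslate

variable {C : TwoExtensionModule M L N} {ξ ξ' : Ext M N 1}

lemma add (h : IsTranslate ξ A B) (h' : IsTranslate ξ' B C) : IsTranslate (ξ' + ξ) A C := by
  rw [IsTranslate, Ext.add_comp, add_assoc]
  exact (InducedByPush.isTranslate_iff h).1 h'

lemma zero (A : TwoExtensionModule M L N) : IsTranslate 0 A A := by
  rw [IsTranslate, Ext.zero_comp, zero_add]
  exact .refl A

lemma congr_left (φ : FilteredIso A B) : IsTranslate ξ A C ↔ IsTranslate ξ B C :=
  (InducedByPush.isTranslate_iff (nonempty_filteredIso_iff_push.1 ⟨φ⟩)).symm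

lemma iff_nonempty_filteredIso (h : IsTranslate ξ A B) :
    IsTranslate ξ A C ↔ Nonempty (FilteredIso B C) :=
  InducedByPush.iff_nonempty_filteredIso h

-- `F` is the fibre product over `M` of `A` and an extension of `M` by `N` with class `ξ`.
lemma exists_filteredHom_fst_add (h : IsTranslate ξ A B) :
    ∃ F : TwoExtensionModule M L (ModuleCat.of D (N × N)),
      F.pullExtension.cocycle ▹ ModuleCat.ofHom (LinearMap.snd D N N) = F.G₀.π ◃ ξ ∧
      Nonempty (FilteredHom F A (ModuleCat.ofHom (LinearMap.fst D N N)) (𝟙 L) (𝟙 M)) ∧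
      Nonempty (FilteredHom F B (ModuleCat.ofHom (LinearMap.fst D N N + LinearMap.snd D N N))
        (𝟙 L) (𝟙 M)) := by
  obtain ⟨z, z_comp⟩ := A.G₁.exists_ext_comp_addSummandDesc A.pushExtension.cocycle ξ
  obtain ⟨F, hF⟩ := exists_inducedByPush (A.G₁.addSummand N) z
  refine ⟨F, ?_, ?_, ?_⟩
  · have h_snd := hF.pullExtension_cocycle_comp (A.G₁.addSummandDesc 0 (𝟙 N))
    rw [z_comp, addSummand_ι_desc, Ext.mk₀_zero, Ext.comp_zero, zero_add, Ext.comp_mk₀_id] at h_snd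
    convert h_snd using 3
    ext <;> simp
  · convert hF.nonempty_filteredHom (.refl A) ((HomOver.id A.G₁).coprod 0) ?_
    · ext <;> simp
    · exact (z_comp ..).trans (by simp [HomOver.id])
  · convert hF.nonempty_filteredHom h ((HomOver.id A.G₁).coprod (𝟙 N)) ?_
    · ext <;> simp
    · exact (z_comp ..).trans (by simp [HomOver.id, add_comm])

lemma inducedByPull (h : IsTranslate ξ A B) :
    InducedByPull A.G₀ B (A.G₀.π ◃ ξ + A.pullExtension.cocycle) := by
  obtain ⟨F, hF, ⟨φ⟩, ⟨ψ⟩⟩ := h.exists_filteredHom_fst_add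
  let e := Congruence.ofHomOver φ.quot
  let e' := Congruence.ofHomOver ψ.quot
  have hA : F.pullExtension.cocycle ▹ ModuleCat.ofHom (LinearMap.fst D N N) =
      e.iso.hom ◃ A.pullExtension.cocycle := φ.toPull.cocycle_comp
  have hB : F.pullExtension.cocycle ▹
      ModuleCat.ofHom (LinearMap.fst D N N + LinearMap.snd D N N) =
      e'.iso.hom ◃ B.pullExtension.cocycle := ψ.toPull.cocycle_comp
  refine ⟨e'.symm.trans e, e'.hom_comp_injective ?_⟩
  change e'.iso.hom ◃ ((e'.iso.inv ≫ e.iso.hom) ◃ _) = e'.iso.hom ◃ B.pullExtension.cocycle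
  rw [Ext.mk₀_comp_mk₀_assoc, Iso.hom_inv_id_assoc, Ext.comp_add, Ext.mk₀_comp_mk₀_assoc, e.comm_π,
    ← hA, ← hF, ← hB, ModuleCat.ofHom_add, Ext.mk₀_add, Ext.comp_add, add_comm]

end TwoExtensionModule.IsTranslate

theorem InducedByPull.isTranslate_iff {G₀ : OneExtension M L} {y : Ext G₀.G N 1} {ξ : Ext M N 1}
    (h : InducedByPull G₀ A y) : IsTranslate ξ A B ↔ InducedByPull G₀ B (G₀.π ◃ ξ + y) := by
  obtain ⟨e, he : _ = A.pullExtension.cocycle⟩ := h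
  rw [iff_of_congruence e, Ext.comp_add, Ext.mk₀_comp_mk₀_assoc, e.comm_π, he]
  refine ⟨IsTranslate.inducedByPull, fun hB => ?_⟩
  obtain ⟨B', hB' : IsTranslate ξ A B'⟩ := exists_inducedByPush A.G₁ _
  exact hB'.iff_nonempty_filteredIso.2 (hB'.inducedByPull.iff_nonempty_filteredIso.1 hB)

end Induced

namespace OneExtension.Congruence

variable {D : Type u} [Ring D] [Small.{v} D] {M N K : ModuleCat.{v} D} {X Y : OneExtension M N}

lemma comp_addHom_hom (e : Congruence X Y) (ψ : M ⟶ N) (x : Ext K X.G 1) :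
    x ▹ (e.addHom ψ).iso.hom = (((x ▹ X.π) ▹ ψ) ▹ X.ι + x) ▹ e.iso.hom := by
  rw [e.addHom_iso_hom, ← e.comm_ι, Ext.mk₀_add, Ext.comp_add, ← comp_mk₀_comp_mk₀,
    ← comp_mk₀_comp_mk₀, ← comp_mk₀_comp_mk₀, Ext.add_comp, add_comm]

lemma addHom_hom_comp (e : Congruence X Y) (ψ : M ⟶ N) (y : Ext Y.G K 1) :
    (e.addHom ψ).iso.hom ◃ y = e.iso.hom ◃ (Y.π ◃ (ψ ◃ (Y.ι ◃ y)) + y) := by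
  rw [e.addHom_iso_hom, ← e.comm_π, Ext.mk₀_add, Ext.add_comp, Ext.comp_add, add_comm]
  simp only [Ext.mk₀_comp_mk₀_assoc, Category.assoc]

end OneExtension.Congruence

section Fibers

variable {D : Type u} [Ring D] [Small.{v} D] {M L N : ModuleCat.{v} D}
  {η : Ext M L 1} {η' : Ext L N 1} {A : TwoExtensionModule M L N}

namespace InducedByPush

variable {G₁ : OneExtension L N}

theorem iff_exists_hom {x y : Ext M G₁.G 1} (h : InducedByPush G₁ A x) :
    InducedByPush G₁ A y ↔ ∃ ψ : L ⟶ N, ((y ▹ G₁.π) ▹ ψ) ▹ G₁.ι + y = x := by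
  obtain ⟨e, he⟩ := h
  constructor
  · rintro ⟨e', he'⟩
    obtain ⟨ψ, hψ⟩ := e.exists_hom_eq_addHom e'
    refine ⟨ψ, e.comp_hom_injective ?_⟩
    change _ ▹ e.iso.hom = x ▹ e.iso.hom
    rw [← e.comp_addHom_hom, ← hψ, he, he']
  · rintro ⟨ψ, rfl⟩
    exact ⟨e.addHom ψ, (e.comp_addHom_hom ψ y).trans he⟩

lemma iff_orbitRel {x y : PushFiber G₁ η} (h : InducedByPush G₁ A x.1) :
    InducedByPush G₁ A y.1 ↔ AddAction.orbitRel (compHom η N) (PushFiber G₁ η) x y := by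
  rw [h.iff_exists_hom, y.2, AddAction.orbitRel_apply, AddAction.mem_orbit_iff]
  constructor
  · rintro ⟨ψ, hψ⟩
    exact ⟨⟨_, mem_compHom.2 ⟨ψ, rfl⟩⟩, Subtype.ext hψ⟩
  · rintro ⟨⟨_, ψ, rfl⟩, hψ⟩
    exact ⟨ψ, congrArg Subtype.val hψ⟩

end InducedByPush

namespace InducedByPull

variable {G₀ : OneExtension M L}

theorem iff_exists_hom {x y : Ext G₀.G N 1} (h : InducedByPull G₀ A x) :
    InducedByPull G₀ A y ↔ ∃ φ : M ⟶ L, G₀.π ◃ (φ ◃ (G₀.ι ◃ y)) + y = x := by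
  obtain ⟨e, he⟩ := h
  constructor
  · rintro ⟨e', he'⟩
    obtain ⟨φ, hφ⟩ := e.exists_hom_eq_addHom e'
    refine ⟨φ, e.hom_comp_injective ?_⟩
    change e.iso.hom ◃ _ = e.iso.hom ◃ x
    rw [← e.addHom_hom_comp, ← hφ, he, he']
  · rintro ⟨φ, rfl⟩
    exact ⟨e.addHom φ, (e.addHom_hom_comp φ y).trans he⟩

lemma iff_orbitRel {x y : PullFiber G₀ η'} (h : InducedByPull G₀ A x.1) :
    InducedByPull G₀ A y.1 ↔ AddAction.orbitRel (homComp M η') (PullFiber G₀ η') x y := by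
  rw [h.iff_exists_hom, y.2, AddAction.orbitRel_apply, AddAction.mem_orbit_iff]
  constructor
  · rintro ⟨φ, hφ⟩
    exact ⟨⟨_, mem_homComp.2 ⟨φ, rfl⟩⟩, Subtype.ext hφ⟩
  · rintro ⟨⟨_, φ, rfl⟩, hφ⟩
    exact ⟨φ, congrArg Subtype.val hφ⟩

end InducedByPull

namespace PushFiber

variable {G₁ : OneExtension L N}

instance : AddAction.IsPretransitive (Ext M N 1) (PushFiber G₁ η) where
  exists_vadd_eq x y := by
    obtain ⟨ξ, hξ⟩ := G₁.exists_comp_ι_eq (y.1 - x.1) (by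
      rw [sub_eq_add_neg, Ext.add_comp, Ext.neg_comp, x.2, y.2, add_neg_cancel])
    exact ⟨ξ, Subtype.ext (eq_sub_iff_add_eq.1 hξ)⟩

lemma stabilizer_eq (x : PushFiber G₁ η) :
    AddAction.stabilizer (Ext M N 1) x = homComp M G₁.cocycle := by
  ext ξ
  exact Subtype.ext_iff.trans (add_eq_right.trans (G₁.comp_ι_eq_zero_iff ξ))

end PushFiber

end Fibers

namespace AdmissibleModule

variable {D : Type u} [Ring D] [Small.{v} D] {M L N : ModuleCat.{v} D}
  {η : Ext M L 1} {η' : Ext L N 1} {G₁ : OneExtension L N} {G₀ : OneExtension M L}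

lemma exists_inducedByPush (A : AdmissibleModule η η') (h : G₁.cocycle = η') :
    ∃ x : PushFiber G₁ η, InducedByPush G₁ A.1 x.1 := by
  obtain ⟨x, hx⟩ := InducedByPush.exists_of_cocycle_eq (h.trans A.2.2.symm)
  exact ⟨⟨x, hx.comp_π.trans A.2.1⟩, hx⟩

lemma exists_inducedByPull (A : AdmissibleModule η η') (h : G₀.cocycle = η) :
    ∃ y : PullFiber G₀ η', InducedByPull G₀ A.1 y.1 := by
  obtain ⟨y, hy⟩ := InducedByPull.exists_of_cocycle_eq (A.2.1.trans h.symm)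
  exact ⟨⟨y, hy.ι_comp.trans A.2.2⟩, hy⟩

lemma exists_of_pushFiber (h : G₁.cocycle = η') (x : PushFiber G₁ η) :
    ∃ A : AdmissibleModule η η', InducedByPush G₁ A.1 x.1 := by
  obtain ⟨A, hA⟩ := OneExtension.exists_inducedByPush G₁ x.1
  exact ⟨⟨A, hA.comp_π.symm.trans x.2, hA.cocycle_eq.symm.trans h⟩, hA⟩

lemma exists_of_pullFiber (h : G₀.cocycle = η) (y : PullFiber G₀ η') :
    ∃ A : AdmissibleModule η η', InducedByPull G₀ A.1 y.1 := by
  obtain ⟨A, hA⟩ := OneExtension.exists_inducedByPull G₀ y.1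
  exact ⟨⟨A, hA.cocycle_eq.trans h, hA.ι_comp.symm.trans y.2⟩, hA⟩

lemma exists_isTranslate (ξ : Ext M N 1) (A : AdmissibleModule η η') :
    ∃ B : AdmissibleModule η η', A.1.IsTranslate ξ B.1 := by
  obtain ⟨x, hx⟩ := A.exists_inducedByPush A.2.2
  obtain ⟨B, hB⟩ := exists_of_pushFiber A.2.2 (ξ +ᵥ x)
  exact ⟨B, hx.isTranslate_iff.2 hB⟩

lemma exists_isTranslate_to (A B : AdmissibleModule η η') :
    ∃ ξ, A.1.IsTranslate ξ B.1 := by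
  obtain ⟨x, hx⟩ := A.exists_inducedByPush A.2.2
  obtain ⟨y, hy⟩ := B.exists_inducedByPush A.2.2
  obtain ⟨ξ, rfl⟩ := AddAction.exists_vadd_eq (Ext M N 1) x y
  exact ⟨ξ, hx.isTranslate_iff.2 hy⟩

lemma isTranslate_self_iff {ξ : Ext M N 1} (A : AdmissibleModule η η') :
    A.1.IsTranslate ξ A.1 ↔ ξ ∈ homComp M η' ⊔ compHom η N := by
  obtain ⟨x, hx⟩ := A.exists_inducedByPush A.2.2
  have mem_homComp_iff (ξ : Ext M N 1) : ξ ∈ homComp M η' ↔ ξ +ᵥ x = x := by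
    rw [← AddAction.mem_stabilizer_iff, x.stabilizer_eq, A.2.2]
  have orbitRel_iff : A.1.IsTranslate ξ A.1 ↔ ∃ ζ : compHom η N, ζ +ᵥ (ξ +ᵥ x) = x :=
    hx.isTranslate_iff.trans (InducedByPush.iff_orbitRel (y := ξ +ᵥ x) hx)
  rw [orbitRel_iff, AddSubgroup.mem_sup]
  constructor
  · rintro ⟨ζ, hζ⟩
    exact ⟨ζ + ξ, (mem_homComp_iff _).2 ((add_vadd ..).trans hζ), -ζ, neg_mem ζ.2, by abel⟩
  · rintro ⟨θ, hθ, ζ, hζ, rfl⟩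
    refine ⟨⟨-ζ, neg_mem hζ⟩, ?_⟩
    change -ζ +ᵥ ((θ + ζ) +ᵥ x) = x
    rw [vadd_vadd, neg_add_cancel_comm_assoc, (mem_homComp_iff θ).1 hθ]

end AdmissibleModule

namespace ExtMod

variable {D : Type u} [Ring D] [Small.{v} D] {M L N : ModuleCat.{v} D}
  {η : Ext M L 1} {η' : Ext L N 1}

lemma mk_eq_mk_iff {A B : AdmissibleModule η η'} :
    mk A = mk B ↔ Nonempty (TwoExtensionModule.FilteredIso A.1 B.1) :=
  Quotient.eq

instance : VAdd (Ext M N 1) (ExtMod η η') where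
  vadd ξ := Quotient.map (fun A => (A.exists_isTranslate ξ).choose) fun A A' ⟨φ⟩ =>
    (A.exists_isTranslate ξ).choose_spec.iff_nonempty_filteredIso.1
      ((TwoExtensionModule.IsTranslate.congr_left φ).2 (A'.exists_isTranslate ξ).choose_spec)

theorem vadd_mk_eq_mk_iff {ξ : Ext M N 1} {A B : AdmissibleModule η η'} :
    ξ +ᵥ mk A = mk B ↔ A.1.IsTranslate ξ B.1 :=
  mk_eq_mk_iff.trans (A.exists_isTranslate ξ).choose_spec.iff_nonempty_filteredIso.symm

instance : AddAction (Ext M N 1) (ExtMod η η') where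
  zero_vadd := by
    rintro ⟨A⟩
    exact vadd_mk_eq_mk_iff.2 (.zero A.1)
  add_vadd ξ ξ' := by
    rintro ⟨A⟩
    obtain ⟨B, hB⟩ := A.exists_isTranslate ξ'
    obtain ⟨C, hC⟩ := B.exists_isTranslate ξ
    change (ξ + ξ') +ᵥ mk A = ξ +ᵥ (ξ' +ᵥ mk A)
    rw [vadd_mk_eq_mk_iff.2 hB, vadd_mk_eq_mk_iff.2 hC, vadd_mk_eq_mk_iff]
    exact hB.add hC

instance : AddAction.IsPretransitive (Ext M N 1) (ExtMod η η') where
  exists_vadd_eq := by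
    rintro ⟨A⟩ ⟨B⟩
    exact (A.exists_isTranslate_to B).imp fun _ => vadd_mk_eq_mk_iff.2

theorem stabilizer_eq (E : ExtMod η η') :
    AddAction.stabilizer (Ext M N 1) E = homComp M η' ⊔ compHom η N := by
  induction E using Quotient.inductionOn with | _ A
  ext ξ
  exact vadd_mk_eq_mk_iff.trans A.isTranslate_self_iff

end ExtMod

theorem exists_addTorsor_quotient_of_stabilizer_eq {V P : Type*} [AddCommGroup V] [AddAction V P]
    [Nonempty P] [AddAction.IsPretransitive V P] {H : AddSubgroup V}
    (hH : ∀ p : P, AddAction.stabilizer V p = H) :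
    ∃ _ : AddTorsor (V ⧸ H) P, ∀ (v : V) (p : P), (v : V ⧸ H) +ᵥ p = v +ᵥ p := by
  have vadd_eq_vadd_iff (v w : V) (p : P) : v +ᵥ p = w +ᵥ p ↔ (v : V ⧸ H) = w := by
    rw [QuotientAddGroup.eq, ← hH p, AddAction.mem_stabilizer_iff, add_vadd, neg_vadd_eq_iff,
      eq_comm]
  choose d hd using AddAction.exists_vadd_eq V (α := P)
  let : AddAction (V ⧸ H) P :=
    { vadd := fun q p => Quotient.liftOn' q (· +ᵥ p) fun v w h =>
        (vadd_eq_vadd_iff v w p).2 (Quotient.sound' h)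
      zero_vadd := zero_vadd V
      add_vadd := by
        rintro ⟨v⟩ ⟨w⟩ p
        exact add_vadd v w p }
  exact ⟨
    { vsub := fun p q => (d q p : V)
      vsub_vadd' := fun p q => hd q p
      vadd_vsub' := by
        rintro ⟨v⟩ p
        exact (vadd_eq_vadd_iff _ v p).1 (hd p (v +ᵥ p)) }, fun _ _ => rfl⟩

theorem exists_equiv_quotient {α β : Type*} (s : Setoid α) (t : Setoid β) (I : α → β → Prop)
    (hα : ∀ a, ∃ b, I a b) (hβ : ∀ b, ∃ a, I a b)
    (hs : ∀ {a a' b}, I a b → (I a' b ↔ s a a')) (ht : ∀ {a b b'}, I a b → (I a b' ↔ t b b')) :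
    ∃ Φ : Quotient s ≃ Quotient t, ∀ a b, Φ (Quotient.mk s a) = Quotient.mk t b ↔ I a b := by
  choose f hf using hα
  choose g hg using hβ
  refine ⟨⟨Quotient.map f ?_, Quotient.map g ?_, ?_, ?_⟩, ?_⟩
  · exact fun a a' h => (ht (hf a)).1 ((hs (hf a')).2 (s.symm h))
  · exact fun b b' h => (hs (hg b)).1 ((ht (hg b')).2 (t.symm h))
  · rintro ⟨a⟩
    exact Quotient.sound ((hs (hg _)).1 (hf a))
  · rintro ⟨b⟩
    exact Quotient.sound ((ht (hf _)).1 (hg b))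
  · intro a b
    exact Quotient.eq.trans (ht (hf a)).symm

end

theorem mainTheorem2 {D : Type u} [Ring D] [Small.{v} D] {M L N : ModuleCat.{v} D}
    (η : Ext M L 1) (η' : Ext L N 1) :
    -- `ExtMod(η, η')` is a principal homogeneous space, for the action that the actions of
    -- `Ext¹(M, N)` on the two fibers induce
    (Nonempty (ExtMod η η') →
      ∃ _ : AddTorsor (ExtOfCocycles η η') (ExtMod η η'),
        (∀ G₁ : OneExtension L N, G₁.cocycle = η' →
          ∀ (ξ : Ext M N 1) (x : PushFiber G₁ η) (A B : AdmissibleModule η η'),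
            InducedByPush G₁ A.1 x.1 → InducedByPush G₁ B.1 (ξ +ᵥ x).1 →
              (QuotientAddGroup.mk ξ : ExtOfCocycles η η') +ᵥ ExtMod.mk A = ExtMod.mk B) ∧
        (∀ G₀ : OneExtension M L, G₀.cocycle = η →
          ∀ (ξ : Ext M N 1) (y : PullFiber G₀ η') (A B : AdmissibleModule η η'),
            InducedByPull G₀ A.1 y.1 → InducedByPull G₀ B.1 (ξ +ᵥ y).1 →
              (QuotientAddGroup.mk ξ : ExtOfCocycles η η') +ᵥ ExtMod.mk A = ExtMod.mk B)) ∧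
    -- `ExtMod(η, η') ≅ (π_*)⁻¹(η) / (η ∘ Hom(L, N))`
    (∀ G₁ : OneExtension L N, G₁.cocycle = η' →
      ∃ Φ : ExtMod η η' ≃ AddAction.orbitRel.Quotient (compHom η N) (PushFiber G₁ η),
        ∀ (A : AdmissibleModule η η') (x : PushFiber G₁ η),
          Φ (ExtMod.mk A) = Quotient.mk _ x ↔ InducedByPush G₁ A.1 x.1) ∧
    -- `ExtMod(η, η') ≅ (ι^*)⁻¹(η') / (Hom(M, L) ∘ η')`
    (∀ G₀ : OneExtension M L, G₀.cocycle = η →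
      ∃ Ψ : ExtMod η η' ≃ AddAction.orbitRel.Quotient (homComp M η') (PullFiber G₀ η'),
        ∀ (A : AdmissibleModule η η') (y : PullFiber G₀ η'),
          Ψ (ExtMod.mk A) = Quotient.mk _ y ↔ InducedByPull G₀ A.1 y.1) := by
  refine ⟨fun hne => ?_, fun G₁ hG₁ => ?_, fun G₀ hG₀ => ?_⟩
  · obtain ⟨T, hT⟩ :=
      exists_addTorsor_quotient_of_stabilizer_eq (ExtMod.stabilizer_eq (η := η) (η' := η'))
    refine ⟨T, fun G₁ _ ξ x A B hA hB => ?_, fun G₀ _ ξ y A B hA hB => ?_⟩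
    · exact (hT ξ _).trans (ExtMod.vadd_mk_eq_mk_iff.2 (hA.isTranslate_iff.2 hB))
    · exact (hT ξ _).trans (ExtMod.vadd_mk_eq_mk_iff.2 (hA.isTranslate_iff.2 hB))
  · exact exists_equiv_quotient (admissibleSetoid η η')
      (AddAction.orbitRel (compHom η N) (PushFiber G₁ η))
      (fun A x => InducedByPush G₁ A.1 x.1) (·.exists_inducedByPush hG₁)
      (AdmissibleModule.exists_of_pushFiber hG₁) (fun h => h.iff_nonempty_filteredIso)
      InducedByPush.iff_orbitRel
  · exact exists_equiv_quotient (admissibleSetoid η η')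
      (AddAction.orbitRel (homComp M η') (PullFiber G₀ η'))
      (fun A y => InducedByPull G₀ A.1 y.1) (·.exists_inducedByPull hG₀)
      (AdmissibleModule.exists_of_pullFiber hG₀) (fun h => h.iff_nonempty_filteredIso)
      InducedByPull.iff_orbitRel
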